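/- There are positive constants $q, K, c_1$ and $\gamma<1$, and one may take $q=14^3$, $K=0.1$, $\gamma=2^{-1/5}$ and $c_1=2^{6/5}$, with the following property. Let $p\ge q$ be a prime such that $2$ is primitive modulo $p$ and $2^{p-1}\not\equiv 1 \pmod{p^2}$, and let $n=p^m$ with $m\ge 1$. For real $w$ let $B_{2n}(w)$ be the set of nonzero vectors of $\{0,1\}^{2n}$ of Hamming weight at most $w$. Then $|B_{2n}(2Kn)|\le 2^n$. Moreover, for every positive real number $w$ with $K\le w/2n\le 1/4$ and every binary cyclic code $C$ of length $n$ whose generator polynomial (the monic divisor of $Z^n+1$ in $\mathbb F_2[Z]$ that generates $C$) is not a multiple of $$P_n(Z)=1+Z^{n/p}+Z^{2n/p}+\cdots+Z^{(p-1)n/p},$$ one has $$\sum_{i+j\le w}A_i(C)A_j(C)\frac1{|C|}\le c_1\,\frac{|B_{2n}(w)|}{2^n}\,\gamma^{\,n-\dim C},$$ where $A_i(C)$ is the number of codewords of $C$ of Hamming weight $i$. -/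

import Mathlib

open Polynomial

/-- The cyclic shift `(x_0, x_1, …, x_{n-1}) ↦ (x_{n-1}, x_0, …, x_{n-2})` of a binary vector. -/
def cyclicShift {n : ℕ} (x : Fin n → ZMod 2) : Fin n → ZMod 2 :=
  fun i => x ((finRotate n).symm i)

/-- A binary cyclic code of length `n`: a linear code that is stable under the cyclic shift. -/
def IsCyclicCode {n : ℕ} (C : Submodule (ZMod 2) (Fin n → ZMod 2)) : Prop :=
  ∀ x ∈ C, cyclicShift x ∈ C

/-- The polynomial representation `x_0 + x_1 Z + ⋯ + x_{n-1} Z^{n-1}` of a binary vector. -/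
noncomputable def vecPoly {n : ℕ} (x : Fin n → ZMod 2) : (ZMod 2)[X] :=
  ∑ i : Fin n, C (x i) * X ^ (i : ℕ)

/-- `g` is the generator polynomial of the code `D` of length `n`: the monic divisor of `Z ^ n + 1`
such that `D` consists of the vectors whose polynomial representation is a multiple of `g`.
Since `g` divides `Z ^ n + 1`, being a multiple of `g` means the same in `𝔽₂[Z]` and in
`𝔽₂[Z] / (Z ^ n + 1)`. -/
def IsGeneratorPoly {n : ℕ} (D : Submodule (ZMod 2) (Fin n → ZMod 2)) (g : (ZMod 2)[X]) : Prop :=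
  g.Monic ∧ g ∣ X ^ n + 1 ∧ ∀ x : Fin n → ZMod 2, x ∈ D ↔ g ∣ vecPoly x

/-- The polynomial `P_n(Z) = 1 + Z^{n/p} + Z^{2n/p} + ⋯ + Z^{(p-1)n/p}` (used when `p ∣ n`). -/
noncomputable def repetitionPoly (p n : ℕ) : (ZMod 2)[X] :=
  ∑ k ∈ Finset.range p, X ^ (k * (n / p))

/-- The set of cyclic codes of length `n` whose generator polynomial is not a multiple of
`P_n(Z)`. -/
def nonRepetitiveCyclicCodes (p n : ℕ) : Set (Submodule (ZMod 2) (Fin n → ZMod 2)) :=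
  {D | IsCyclicCode D ∧ ∃ g, IsGeneratorPoly D g ∧ ¬ repetitionPoly p n ∣ g}

/-- `A_i(D)`: the number of codewords of Hamming weight `i`. -/
noncomputable def weightCount {n : ℕ} (D : Submodule (ZMod 2) (Fin n → ZMod 2)) (i : ℕ) : ℕ :=
  Set.ncard {x : Fin n → ZMod 2 | x ∈ D ∧ hammingNorm x = i}

/-- `B_N(w)`: the set of nonzero binary vectors of length `N` and weight at most the real `w`. -/
def puncturedBall (N : ℕ) (w : ℝ) : Set (Fin N → ZMod 2) :=
  {x | x ≠ 0 ∧ (hammingNorm x : ℝ) ≤ w}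

/-- The sum of `A_i(D) A_j(D)` over all pairs of weights `i, j` with `i + j ≤ w`
(weights of vectors of length `n` lie between `0` and `n`). -/
noncomputable def pairWeightSum {n : ℕ} (D : Submodule (ZMod 2) (Fin n → ZMod 2)) (w : ℝ) : ℕ :=
  ∑ ij ∈ (Finset.range (n + 1) ×ˢ Finset.range (n + 1)).filter
      (fun ij : ℕ × ℕ => (ij.1 : ℝ) + (ij.2 : ℝ) ≤ w),
    weightCount D ij.1 * weightCount D ij.2

/-! Put s = n/p. The hypotheses on 2 make P_n, the cyclotomic polynomial of order n, irreducible
over 𝔽₂, so a generator g that is not a multiple of it divides Z^s - 1. The codimension is r = deg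
g, and either r ≤ 1 or r ≥ p - 1 (`natDegree_le_one_or_pred_le`). For r ≤ 1 the trivial count of
pairs suffices.

For r ≥ p - 1, group coordinates by residue mod s. Folding a codeword mod s keeps it a multiple of
g, so its coordinates with residue ≥ r determine the parities of the r blocks with residue < r
(`sum_residue_eq_zero`). A pair of codewords is thus a word of length N = 2n with 2r constrained
blocks of length p. Fixing the parity of a block replaces its weight enumerator (1+t)^p by about
half of it, so the 2r blocks save nearly 2^(-2r), while |C|/2^n costs only 2^r. At the saddle point
t = W/(N-W), where W = ⌊w⌋, this saving transfers from generating functions to the ball, up to a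
factor polynomial in M = 2rp (`DeterminesParities.card_pairBall_le`); as p ≤ r + 1, the factor is
absorbed (`pairCount_factor_le`). -/

/-! ### Weight enumerators, with and without parity constraints. -/

theorem sum_pow_hammingNorm {ι R : Type*} [Fintype ι] [DecidableEq ι] [CommSemiring R] (c : R) :
    ∑ v : ι → ZMod 2, c ^ hammingNorm v = (1 + c) ^ Fintype.card ι := by
  have h1 : ∀ v : ι → ZMod 2, c ^ hammingNorm v = ∏ i, (if v i ≠ 0 then c else 1) := fun v => by
    rw [hammingNorm, Finset.prod_ite]
    simp
  have h2 : ∑ a : ZMod 2, (if a ≠ 0 then c else 1) = 1 + c := by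
    have : (Finset.univ : Finset (ZMod 2)) = {0, 1} := rfl
    rw [this]
    simp
  rw [Finset.sum_congr rfl fun v _ => h1 v, ← Fintype.piFinset_univ,
    ← Finset.prod_univ_sum (fun _ => Finset.univ) fun _ a => if a ≠ (0 : ZMod 2) then c else 1]
  simp only [h2, Finset.prod_const, Finset.card_univ]

theorem card_hammingNorm_eq {ι : Type*} [Fintype ι] [DecidableEq ι] (k : ℕ) :
    (Finset.univ.filter fun v : ι → ZMod 2 => hammingNorm v = k).card =
      (Fintype.card ι).choose k := by
  have h := congrArg (fun q : ℕ[X] => q.coeff k) (sum_pow_hammingNorm (ι := ι) (X : ℕ[X]))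
  simp only [finsetSum_coeff, coeff_X_pow, coeff_one_add_X_pow] at h
  rw [Finset.card_filter]
  simpa [eq_comm] using h

theorem natCast_hammingNorm {ι : Type*} [Fintype ι] (v : ι → ZMod 2) :
    (hammingNorm v : ZMod 2) = ∑ i, v i := by
  rw [hammingNorm, Finset.card_filter, Nat.cast_sum]
  refine Finset.sum_congr rfl fun i _ => ?_
  generalize v i = a
  revert a
  decide

/-- Averaging the enumerators at t and -t, the latter with sign (-1)^b, selects the parity b. Since
1 - t ≥ 0, dropping the sign gives a bound independent of b. -/
theorem sum_pow_hammingNorm_parity_le {ι : Type*} [Fintype ι] [DecidableEq ι] {t : ℝ}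
    (ht : 0 ≤ t) (ht1 : t ≤ 1) (b : ZMod 2) :
    ∑ v : ι → ZMod 2, (if ∑ i, v i = b then t ^ hammingNorm v else 0) ≤
      ((1 + t) ^ Fintype.card ι + (1 - t) ^ Fintype.card ι) / 2 := by
  have hpt : ∀ v : ι → ZMod 2, (if ∑ i, v i = b then t ^ hammingNorm v else 0) ≤
      (t ^ hammingNorm v + (-1) ^ b.val * (-t) ^ hammingNorm v) / 2 := fun v => by
    have hb : (b.val : ZMod 2) = b := ZMod.natCast_zmod_val b
    have hpos : 0 ≤ t ^ hammingNorm v := pow_nonneg ht _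
    rw [neg_pow t, ← mul_assoc, ← pow_add]
    split_ifs with h
    · have : Even (b.val + hammingNorm v) := by
        rw [even_iff_two_dvd, ← CharP.cast_eq_zero_iff (ZMod 2) 2]
        push_cast
        rw [hb, natCast_hammingNorm, h]
        exact CharTwo.add_self_eq_zero b
      rw [this.neg_one_pow]
      linarith
    · rcases neg_one_pow_eq_or ℝ (b.val + hammingNorm v) with h' | h' <;> rw [h'] <;> linarith
  refine (Finset.sum_le_sum fun v _ => hpt v).trans ?_
  rw [← Finset.sum_div, Finset.sum_add_distrib, ← Finset.mul_sum, sum_pow_hammingNorm,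
    sum_pow_hammingNorm, ← sub_eq_add_neg]
  have h0 : 0 ≤ (1 - t) ^ Fintype.card ι := pow_nonneg (by linarith) _
  rcases neg_one_pow_eq_or ℝ b.val with h' | h' <;> rw [h'] <;> linarith

theorem sum_pow_blockParity_le {κ ι : Type*} [Fintype κ] [DecidableEq κ] [Fintype ι]
    [DecidableEq ι] {t : ℝ} (ht : 0 ≤ t) (ht1 : t ≤ 1) (b : κ → ZMod 2) :
    ∑ y : κ → ι → ZMod 2, (if ∀ k, ∑ i, y k i = b k then t ^ ∑ k, hammingNorm (y k) else 0) ≤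
      (((1 + t) ^ Fintype.card ι + (1 - t) ^ Fintype.card ι) / 2) ^ Fintype.card κ := by
  have h1 : ∀ y : κ → ι → ZMod 2,
      (if ∀ k, ∑ i, y k i = b k then t ^ ∑ k, hammingNorm (y k) else 0) =
      ∏ k, (if ∑ i, y k i = b k then t ^ hammingNorm (y k) else 0) := fun y => by
    split_ifs with h
    · simp [h, Finset.prod_pow_eq_pow_sum]
    · push Not at h
      obtain ⟨k, hk⟩ := h
      exact (Finset.prod_eq_zero (Finset.mem_univ k) (by simp [hk])).symm
  rw [Finset.sum_congr rfl fun y _ => h1 y, ← Fintype.piFinset_univ,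
    ← Finset.prod_univ_sum (fun _ => Finset.univ)
      fun k (v : ι → ZMod 2) => if ∑ i, v i = b k then t ^ hammingNorm v else 0]
  refine (Finset.prod_le_prod (fun k _ => Finset.sum_nonneg fun v _ => ?_)
    fun k _ => sum_pow_hammingNorm_parity_le ht ht1 (b k)).trans ?_
  · split_ifs <;> positivity
  · rw [Finset.prod_const, Finset.card_univ]

/-! ### Comparison of binomial coefficients. -/

/-- Up to about Q/3, consecutive binomial coefficients at least double, so the sum is dominated
geometrically by its last term. -/
theorem sum_range_choose_le_two_mul {Q k : ℕ} (h : 3 * k ≤ Q + 1) :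
    ∑ i ∈ Finset.range (k + 1), Q.choose i ≤ 2 * Q.choose k := by
  induction k with
  | zero => simp
  | succ k ih =>
    rw [Finset.sum_range_succ]
    have h1 := ih (by omega)
    have h2 := Nat.choose_succ_right_eq Q k
    have h3 : Q.choose k * (2 * (k + 1)) ≤ Q.choose k * (Q - k) :=
      Nat.mul_le_mul_left _ (by omega)
    have h4 : 2 * Q.choose k ≤ Q.choose (k + 1) := by
      refine Nat.le_of_mul_le_mul_right (c := k + 1) ?_ (by omega)
      rw [h2]
      linarith
    omega

theorem choose_sub_le {Q W j : ℕ} (hj : j ≤ W) (hW : W < Q) :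
    (Q.choose (W - j) : ℝ) ≤ ((W : ℝ) / (Q - W)) ^ j * Q.choose W := by
  have hQW : (0 : ℝ) < Q - W := sub_pos.2 (by exact_mod_cast hW)
  induction j with
  | zero => simp
  | succ j ih =>
    refine le_trans ?_ (le_of_le_of_eq
      (mul_le_mul_of_nonneg_left (ih (by omega)) (a := (W : ℝ) / (Q - W)) (by positivity))
      (by ring))
    obtain ⟨k, hk⟩ : ∃ k, W - j = k + 1 := ⟨W - j - 1, by omega⟩
    have hk' : W - (j + 1) = k := by omega
    rw [hk', hk]
    have h2 := Nat.choose_succ_right_eq Q k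
    have h3 : (Q.choose (k + 1) : ℝ) * (k + 1) = Q.choose k * (Q - k) := by
      rw [← Nat.cast_sub (by omega)]
      exact_mod_cast h2
    rw [div_mul_eq_mul_div, le_div_iff₀ hQW]
    have hkW : (k : ℝ) + 1 ≤ W := by exact_mod_cast (by omega : k + 1 ≤ W)
    calc (Q.choose k : ℝ) * (Q - W) ≤ Q.choose k * (Q - k) := by gcongr; omega
      _ = (k + 1) * Q.choose (k + 1) := by rw [← h3]; ring
      _ ≤ W * Q.choose (k + 1) := by gcongr

/-- Each factor C(K+1,W)/C(K,W) = (K+1)/(K+1-W) with K + 1 ≤ N is at least N/(N-W). -/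
theorem pow_mul_choose_sub_le {N W M : ℕ} (hM : M ≤ N) (hW : W < N) :
    ((N : ℝ) / (N - W)) ^ M * (N - M).choose W ≤ N.choose W := by
  have hNW : (0 : ℝ) < N - W := sub_pos.2 (by exact_mod_cast hW)
  induction M with
  | zero => simp
  | succ M ih =>
    refine le_trans ?_ (ih (by omega))
    rw [pow_succ, mul_assoc]
    refine mul_le_mul_of_nonneg_left ?_ (by positivity)
    obtain ⟨K, hK⟩ : ∃ K, N - M = K + 1 := ⟨N - M - 1, by omega⟩
    have hK' : N - (M + 1) = K := by omega
    rw [hK', hK]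
    rcases lt_or_ge K W with h | h
    · simp [Nat.choose_eq_zero_of_lt h]
    · have h3 : ((K : ℝ) + 1) * K.choose W = (K + 1).choose W * (K + 1 - W) := by
        have := Nat.choose_mul_succ_eq K W
        rw [← Nat.cast_add_one, ← Nat.cast_sub (by omega)]
        rw [mul_comm]
        exact_mod_cast this
      rw [div_mul_eq_mul_div, div_le_iff₀ hNW]
      have hKN : (K : ℝ) + 1 ≤ N := by exact_mod_cast (by omega : K + 1 ≤ N)
      have hWK : (W : ℝ) ≤ K := by exact_mod_cast h
      have hpos : (0 : ℝ) ≤ K.choose W := Nat.cast_nonneg _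
      have hW0 : (0 : ℝ) ≤ W := Nat.cast_nonneg _
      have key : (N : ℝ) * (K + 1 - W) ≤ (K + 1) * (N - W) := by nlinarith
      have hd : (0 : ℝ) < K + 1 - W := by linarith
      refine le_of_mul_le_mul_right ?_ hd
      calc (N : ℝ) * K.choose W * (K + 1 - W) = K.choose W * (N * (K + 1 - W)) := by ring
        _ ≤ K.choose W * ((K + 1) * (N - W)) := by gcongr
        _ = (K + 1) * K.choose W * (N - W) := by ring
        _ = _ := by rw [h3]; ring

/-- With t = W/(N-W), consecutive terms of (1+t)^N have ratio t(N-k)/(k+1), which is at least 1 for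
k < W and at most 1 for k ≥ W. Hence the term of index W is the largest. -/
theorem choose_mul_pow_le {N W : ℕ} (hW0 : 0 < W) (hW : W < N) {k : ℕ} (hk : k ≤ N) :
    (N.choose k : ℝ) * ((W : ℝ) / (N - W)) ^ k ≤ N.choose W * ((W : ℝ) / (N - W)) ^ W := by
  have hNW : (0 : ℝ) < N - W := sub_pos.2 (by exact_mod_cast hW)
  have hWp : (0 : ℝ) < W := by exact_mod_cast hW0
  set t : ℝ := (W : ℝ) / (N - W) with ht
  have htp : 0 < t := by positivity
  have htW : t * (N - W) = W := div_mul_cancel₀ _ hNW.ne'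
  have hstep : ∀ k < N, (N.choose (k + 1) : ℝ) * (k + 1) = N.choose k * (N - k) := fun k hk => by
    rw [← Nat.cast_sub hk.le]
    exact_mod_cast Nat.choose_succ_right_eq N k
  rcases le_total W k with h | h
  · induction k, h using Nat.le_induction with
    | base => exact le_rfl
    | succ k hkW ih =>
      refine le_trans ?_ (ih (by omega))
      rw [pow_succ, mul_comm (t ^ k), ← mul_assoc]
      refine mul_le_mul_of_nonneg_right ?_ (by positivity)
      have hkW' : (W : ℝ) ≤ k := by exact_mod_cast hkW
      have hkN' : (k : ℝ) + 1 ≤ N := by exact_mod_cast hk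
      refine le_of_mul_le_mul_right (a := (k : ℝ) + 1) ?_ (by positivity)
      calc (N.choose (k + 1) : ℝ) * t * (k + 1) = N.choose (k + 1) * (k + 1) * t := by ring
        _ = N.choose k * (t * (N - k)) := by rw [hstep k (by omega)]; ring
        _ ≤ N.choose k * (k + 1) := by gcongr; nlinarith
  · obtain ⟨d, rfl⟩ := Nat.exists_eq_add_of_le h
    have : ∀ e ≤ d, (N.choose k : ℝ) * t ^ k ≤ N.choose (k + e) * t ^ (k + e) := by
      intro e
      induction e with
      | zero => simp
      | succ e ih =>
        intro he
        refine (ih (by omega)).trans ?_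
        rw [← add_assoc, pow_succ, mul_comm (t ^ (k + e)), ← mul_assoc]
        refine mul_le_mul_of_nonneg_right ?_ (by positivity)
        have h1 : ((k + e : ℕ) : ℝ) + 1 ≤ ((k + d : ℕ) : ℝ) := by
          exact_mod_cast (by omega : k + e + 1 ≤ k + d)
        refine le_of_mul_le_mul_right (a := ((k + e : ℕ) : ℝ) + 1) ?_ (by positivity)
        calc (N.choose (k + e) : ℝ) * (((k + e : ℕ) : ℝ) + 1)
            ≤ N.choose (k + e) * (t * (N - (k + e : ℕ))) := by gcongr; nlinarith
          _ = N.choose (k + e + 1) * (((k + e : ℕ) : ℝ) + 1) * t := by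
              rw [hstep (k + e) (by omega)]; ring
          _ = _ := by ring
    exact this d le_rfl

theorem one_add_pow_le_mul_choose {N W : ℕ} (hW0 : 0 < W) (hW : W < N) :
    (1 + (W : ℝ) / (N - W)) ^ N ≤ (N + 1) * (N.choose W * ((W : ℝ) / (N - W)) ^ W) := by
  rw [add_comm, add_pow]
  refine (Finset.sum_le_card_nsmul _ _ (N.choose W * ((W : ℝ) / (N - W)) ^ W)
    fun k hk => ?_).trans (le_of_eq ?_)
  · rw [one_pow, mul_one, mul_comm]
    exact choose_mul_pow_le hW0 hW (by simpa [Nat.lt_succ_iff] using hk)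
  · simp

/-! ### Small-weight words whose block parities are determined by the outer part. -/

/-- The number of pairs `(u, y)` in `S` whose total Hamming weight is at most `W`. -/
noncomputable def pairBall {O κ ι : Type*} [Fintype O] [Fintype κ] [Fintype ι]
    (S : Finset ((O → ZMod 2) × (κ → ι → ZMod 2))) (W : ℕ) :
    Finset ((O → ZMod 2) × (κ → ι → ZMod 2)) :=
  S.filter fun z => hammingNorm z.1 + ∑ k, hammingNorm (z.2 k) ≤ W

/-- The outer coordinates of a word in `S` determine the parities of all its blocks. -/
def DeterminesParities {O κ ι : Type*} [Fintype ι]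
    (S : Finset ((O → ZMod 2) × (κ → ι → ZMod 2))) : Prop :=
  ∀ u y y', (u, y) ∈ S → (u, y') ∈ S → ∀ k, ∑ i, y k i = ∑ i, y' k i

section

variable {O κ ι : Type*} [Fintype O] [Fintype κ] [DecidableEq κ] [Fintype ι]
  [DecidableEq ι] {S : Finset ((O → ZMod 2) × (κ → ι → ZMod 2))}

theorem DeterminesParities.sum_fiber_le (hS : DeterminesParities S) {t : ℝ} (ht : 0 ≤ t)
    (ht1 : t ≤ 1) (u : O → ZMod 2) :
    ∑ y : κ → ι → ZMod 2, (if (u, y) ∈ S then t ^ ∑ k, hammingNorm (y k) else 0) ≤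
      (((1 + t) ^ Fintype.card ι + (1 - t) ^ Fintype.card ι) / 2) ^ Fintype.card κ := by
  by_cases h : ∃ y₀, (u, y₀) ∈ S
  · obtain ⟨y₀, hy₀⟩ := h
    refine le_trans (Finset.sum_le_sum fun y _ => ?_)
      (sum_pow_blockParity_le ht ht1 fun k => ∑ i, y₀ k i)
    by_cases hy : (u, y) ∈ S
    · rw [if_pos hy, if_pos (hS u y y₀ hy hy₀)]
    · rw [if_neg hy]
      split_ifs <;> positivity
  · push Not at h
    simp only [h, if_false, Finset.sum_const_zero]
    have : 0 ≤ 1 - t := by linarith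
    positivity

/-- Chernoff's bound: t^W ≤ t^weight on the ball, and the enumerator of S factors through the fibres
over the outer part. -/
theorem DeterminesParities.card_pairBall_mul_pow_le [DecidableEq O] (hS : DeterminesParities S) {t : ℝ}
    (ht : 0 ≤ t) (ht1 : t ≤ 1) (W : ℕ) :
    ((pairBall S W).card : ℝ) * t ^ W ≤ (1 + t) ^ Fintype.card O *
      (((1 + t) ^ Fintype.card ι + (1 - t) ^ Fintype.card ι) / 2) ^ Fintype.card κ := by
  set E := (((1 + t) ^ Fintype.card ι + (1 - t) ^ Fintype.card ι) / 2) ^ Fintype.card κ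
  calc ((pairBall S W).card : ℝ) * t ^ W
      = ∑ z ∈ pairBall S W, t ^ W := by simp
    _ ≤ ∑ z ∈ pairBall S W, t ^ (hammingNorm z.1 + ∑ k, hammingNorm (z.2 k)) :=
        Finset.sum_le_sum fun z hz =>
          pow_le_pow_of_le_one ht ht1 (Finset.mem_filter.1 hz).2
    _ ≤ ∑ z ∈ S, t ^ (hammingNorm z.1 + ∑ k, hammingNorm (z.2 k)) :=
        Finset.sum_le_sum_of_subset_of_nonneg (Finset.filter_subset _ _)
          fun _ _ _ => by positivity
    _ = ∑ u : O → ZMod 2, t ^ hammingNorm u *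
          ∑ y : κ → ι → ZMod 2, (if (u, y) ∈ S then t ^ ∑ k, hammingNorm (y k) else 0) := by
        simp_rw [Finset.mul_sum, mul_ite, mul_zero, ← pow_add]
        rw [← Fintype.sum_prod_type', ← Finset.sum_filter]
        simp
    _ ≤ ∑ u : O → ZMod 2, t ^ hammingNorm u * E :=
        Finset.sum_le_sum fun u _ =>
          mul_le_mul_of_nonneg_left (hS.sum_fiber_le ht ht1 u) (by positivity)
    _ = _ := by rw [← Finset.sum_mul, sum_pow_hammingNorm]

theorem card_hammingNorm_le [DecidableEq O] (k : ℕ) :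
    (Finset.univ.filter fun v : O → ZMod 2 => hammingNorm v ≤ k).card =
      ∑ i ∈ Finset.range (k + 1), (Fintype.card O).choose i := by
  rw [Finset.card_eq_sum_card_fiberwise (f := hammingNorm) (t := Finset.range (k + 1))]
  · refine Finset.sum_congr rfl fun i hi => ?_
    rw [← card_hammingNorm_eq, Finset.filter_filter]
    congr 1
    ext v
    simp only [Finset.mem_filter, Finset.mem_range] at hi ⊢
    simp only [Finset.mem_univ, true_and]
    omega
  · intro v hv
    simp at hv ⊢
    omega

/-- A finer count for when the blocks are a small part of the word: Chernoff's bound is applied only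
to block parts of exact weight j, and the outer parts are counted exactly. -/
theorem DeterminesParities.card_pairBall_le_sum [DecidableEq O] (hS : DeterminesParities S) {t : ℝ}
    (ht : 0 < t) (ht1 : t ≤ 1) (W : ℕ) :
    ((pairBall S W).card : ℝ) ≤
      ∑ j ∈ Finset.range (Fintype.card κ * Fintype.card ι + 1), if j ≤ W then
        ((∑ i ∈ Finset.range (W - j + 1), (Fintype.card O).choose i : ℕ) : ℝ) *
        ((((1 + t) ^ Fintype.card ι + (1 - t) ^ Fintype.card ι) / 2) ^ Fintype.card κ / t ^ j)
        else 0 := by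
  set E := (((1 + t) ^ Fintype.card ι + (1 - t) ^ Fintype.card ι) / 2) ^ Fintype.card κ
  rw [Finset.card_eq_sum_card_fiberwise (f := fun z => ∑ k, hammingNorm (z.2 k))
    (t := Finset.range (Fintype.card κ * Fintype.card ι + 1))]
  · push_cast
    refine Finset.sum_le_sum fun j hj => ?_
    split_ifs with hjW
    · have h1 : ((pairBall S W).filter fun z => ∑ k, hammingNorm (z.2 k) = j) ⊆
          (Finset.univ.filter fun v : O → ZMod 2 => hammingNorm v ≤ W - j).biUnion fun u =>
          (Finset.univ.filter fun y : κ → ι → ZMod 2 => (u, y) ∈ S ∧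
            ∑ k, hammingNorm (y k) = j).image fun y => (u, y) := by
        rintro ⟨u, y⟩ h
        simp only [pairBall, Finset.mem_filter] at h
        simp only [Finset.mem_biUnion, Finset.mem_filter, Finset.mem_univ, true_and,
          Finset.mem_image]
        exact ⟨u, by omega, y, ⟨h.1.1, h.2⟩, rfl⟩
      have h2 : ∀ u, (((Finset.univ.filter fun y : κ → ι → ZMod 2 => (u, y) ∈ S ∧
            ∑ k, hammingNorm (y k) = j).image fun y => (u, y)).card : ℝ) ≤ E / t ^ j := fun u => by
        rw [le_div_iff₀ (by positivity)]
        refine le_trans ?_ (hS.sum_fiber_le ht.le ht1 u)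
        refine (mul_le_mul_of_nonneg_right (Nat.cast_le.2 Finset.card_image_le)
          (by positivity)).trans ?_
        rw [← nsmul_eq_mul, ← Finset.sum_const, Finset.sum_filter]
        refine Finset.sum_le_sum fun y _ => ?_
        by_cases hy : (u, y) ∈ S
        · by_cases hyj : ∑ k, hammingNorm (y k) = j
          · simp [hy, hyj]
          · simp only [hy, hyj, and_false, if_false, if_true]
            positivity
        · simp [hy]
      refine (Nat.cast_le.2 ((Finset.card_le_card h1).trans Finset.card_biUnion_le)).trans ?_
      rw [Nat.cast_sum]
      refine (Finset.sum_le_sum fun u _ => h2 u).trans (le_of_eq ?_)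
      rw [Finset.sum_const, nsmul_eq_mul, card_hammingNorm_le, Nat.cast_sum]
    · refine le_of_eq ?_
      rw [Nat.cast_eq_zero, Finset.card_eq_zero, Finset.filter_eq_empty_iff]
      intro z hz
      have := (Finset.mem_filter.1 hz).2
      omega
  · intro z _
    have : ∑ k, hammingNorm (z.2 k) ≤ ∑ _k : κ, Fintype.card ι :=
      Finset.sum_le_sum fun k _ => hammingNorm_le_card_fintype
    simp at this ⊢
    omega

theorem one_add_div_pow_le_eight {M : ℕ} {x : ℝ} (hx : 0 < x) (hM : (M : ℝ) ^ 2 ≤ 2 * x) :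
    (1 + M / x) ^ M ≤ 8 := by
  calc (1 + M / x) ^ M ≤ (Real.exp (M / x)) ^ M := by
        gcongr
        rw [add_comm]
        exact Real.add_one_le_exp _
    _ = Real.exp (M ^ 2 / x) := by
        rw [← Real.exp_nat_mul]
        congr 1
        ring
    _ ≤ Real.exp 2 := by
        rw [Real.exp_le_exp, div_le_iff₀ hx]
        exact hM
    _ = Real.exp 1 ^ 2 := by
        rw [← Real.exp_nat_mul]
        norm_num
    _ ≤ 8 := by
        have := Real.exp_one_lt_d9
        have := Real.exp_pos 1
        nlinarith

/-- The loss must be polynomial in M and not in N, since N may be far larger than the constrained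
part. Chernoff's bound on the whole word loses N + 1, which is acceptable when N ≤ M²; otherwise the
finer count loses only the M + 1 values of j and a constant. -/
theorem DeterminesParities.card_pairBall_le [DecidableEq O] (hS : DeterminesParities S) {N M W : ℕ}
    (hM : M = Fintype.card κ * Fintype.card ι) (hN : N = Fintype.card O + M) (hM4 : 4 ≤ M)
    (hW0 : 0 < W) (hW1 : N ≤ 20 * W) (hW2 : 4 * W ≤ N)
    (hι : (9 / 10 : ℝ) ^ Fintype.card ι ≤ 1 / 20) :
    ((pairBall S W).card : ℝ) ≤
      16 * ((M : ℝ) ^ 2 + 1) * (21 / 40) ^ Fintype.card κ * N.choose W := by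
  have hNW : (0 : ℝ) < N - W := sub_pos.2 (by exact_mod_cast (by omega : W < N))
  have hWp : (0 : ℝ) < W := by exact_mod_cast hW0
  have hW1' : (N : ℝ) ≤ 20 * W := by exact_mod_cast hW1
  have hW2' : 4 * (W : ℝ) ≤ N := by exact_mod_cast hW2
  set t : ℝ := (W : ℝ) / (N - W) with ht
  have htp : 0 < t := by positivity
  have ht1 : t ≤ 1 := by rw [ht, div_le_one hNW]; linarith
  have ht19 : 1 / 19 ≤ t := by rw [ht, div_le_div_iff₀ (by norm_num) hNW]; linarith
  have hE : (((1 + t) ^ Fintype.card ι + (1 - t) ^ Fintype.card ι) / 2) ^ Fintype.card κ ≤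
      (1 + t) ^ M * (21 / 40) ^ Fintype.card κ := by
    rw [hM, mul_comm (Fintype.card κ), pow_mul, ← mul_pow]
    -- From t ≥ 1/19, (1-t)/(1+t) ≤ 9/10; with `hι` the per-block factor becomes (1 + 1/20)/2 =
    -- 21/40.
    have h1 : (1 - t) ^ Fintype.card ι ≤ (9 / 10 : ℝ) ^ Fintype.card ι *
        (1 + t) ^ Fintype.card ι := by
      rw [← mul_pow]
      exact pow_le_pow_left₀ (by linarith) (by linarith) _
    have h2 : 0 ≤ (1 - t) ^ Fintype.card ι := pow_nonneg (by linarith) _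
    have h3 : 0 < (1 + t) ^ Fintype.card ι := by positivity
    refine pow_le_pow_left₀ (by positivity) ?_ _
    nlinarith
  set E := (((1 + t) ^ Fintype.card ι + (1 - t) ^ Fintype.card ι) / 2) ^ Fintype.card κ
  rcases le_or_gt N (M ^ 2) with hcase | hcase
  · have h1 := hS.card_pairBall_mul_pow_le htp.le ht1 W
    have h2 := one_add_pow_le_mul_choose hW0 (by omega : W < N)
    rw [← ht] at h2
    refine le_of_mul_le_mul_right (h1.trans ?_) (pow_pos htp W)
    have hcase' : (N : ℝ) ≤ (M : ℝ) ^ 2 := by exact_mod_cast hcase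
    calc (1 + t) ^ Fintype.card O * E
        ≤ (1 + t) ^ Fintype.card O * ((1 + t) ^ M * (21 / 40) ^ Fintype.card κ) := by gcongr
      _ = (1 + t) ^ N * (21 / 40) ^ Fintype.card κ := by rw [hN]; ring
      _ ≤ ((N + 1) * (N.choose W * t ^ W)) * (21 / 40) ^ Fintype.card κ := by gcongr
      _ ≤ ((16 * (M ^ 2 + 1)) * (N.choose W * t ^ W)) * (21 / 40) ^ Fintype.card κ := by
          gcongr
          nlinarith
      _ = _ := by ring
  · set Q := Fintype.card O with hQ
    have hNM : N - M = Q := by omega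
    have h4M : 4 * M < N := by nlinarith
    have hQW : (0 : ℝ) < Q - W := sub_pos.2 (by exact_mod_cast (by omega : W < Q))
    have hQN : (N : ℝ) = Q + M := by exact_mod_cast hN
    have h4M' : 4 * (M : ℝ) < N := by exact_mod_cast h4M
    have hcase' : (M : ℝ) ^ 2 < N := by exact_mod_cast hcase
    have hterm : ∀ j ∈ Finset.range (M + 1), (if j ≤ W then
        ((∑ i ∈ Finset.range (W - j + 1), Q.choose i : ℕ) : ℝ) * (E / t ^ j) else 0) ≤
        16 * Q.choose W * E := fun j hj => by
      have hjM : j ≤ M := by simpa [Nat.lt_succ_iff] using hj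
      split_ifs with hjW
      -- Here M < N/4, so Q > 3N/4 ≥ 3W, as the doubling estimate requires.
      · have h1 : ((∑ i ∈ Finset.range (W - j + 1), Q.choose i : ℕ) : ℝ) ≤
            2 * Q.choose (W - j) := by
          exact_mod_cast sum_range_choose_le_two_mul (by omega)
        have h2 : (Q.choose (W - j) : ℝ) ≤ _ := choose_sub_le hjW (by omega)
        have h3 : ((W : ℝ) / (Q - W)) ^ j ≤ 8 * t ^ j := by
          have : (W : ℝ) / (Q - W) = (1 + M / (Q - W)) * t := by
            rw [ht]
            field_simp
            rw [hQN]
            ring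
          rw [this, mul_pow]
          refine mul_le_mul_of_nonneg_right ?_ (by positivity)
          -- M and W are at most N/4, hence 2(Q-W) ≥ N > M².
          refine le_trans (pow_le_pow_right₀ ?_ hjM) (one_add_div_pow_le_eight hQW (by linarith))
          exact le_add_of_nonneg_right (by positivity)
        calc _ ≤ (2 * (8 * t ^ j * Q.choose W)) * (E / t ^ j) := by
              gcongr
              refine h1.trans ?_
              gcongr
              exact h2.trans (by gcongr)
          _ = 16 * Q.choose W * E := by field_simp; ring
      · positivity
    have h5 := pow_mul_choose_sub_le (by omega : M ≤ N) (by omega : W < N)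
    have h6 : (N : ℝ) / (N - W) = 1 + t := by rw [ht]; field_simp; ring
    rw [h6, hNM] at h5
    refine (hS.card_pairBall_le_sum htp ht1 W).trans ?_
    rw [← hM]
    refine (Finset.sum_le_sum hterm).trans ?_
    rw [Finset.sum_const, Finset.card_range, nsmul_eq_mul]
    have hM1 : (M : ℝ) ≤ M ^ 2 := by
      have : (4 : ℝ) ≤ M := by exact_mod_cast hM4
      nlinarith
    push_cast
    calc ((M : ℝ) + 1) * (16 * Q.choose W * E)
        ≤ (M ^ 2 + 1) * (16 * Q.choose W * ((1 + t) ^ M * (21 / 40) ^ Fintype.card κ)) := by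
          gcongr
      _ = 16 * (M ^ 2 + 1) * (21 / 40) ^ Fintype.card κ * ((1 + t) ^ M * Q.choose W) := by ring
      _ ≤ _ := by gcongr

end

/-! ### The order of 2 modulo powers of p, and divisors of Z^(p^k) - 1. -/

theorem pred_dvd_orderOf_two {p : ℕ} (h2 : orderOf (2 : ZMod p) = p - 1) (k : ℕ) :
    p - 1 ∣ orderOf (2 : ZMod (p ^ (k + 1))) := by
  have h := orderOf_map_dvd
    (ZMod.castHom (dvd_pow_self p k.succ_ne_zero) (ZMod p)).toMonoidHom (2 : ZMod (p ^ (k + 1)))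
  have h' : (ZMod.castHom (dvd_pow_self p k.succ_ne_zero) (ZMod p)).toMonoidHom
    (2 : ZMod (p ^ (k + 1))) = 2 := map_ofNat (ZMod.castHom _ (ZMod p)) 2
  rwa [h', h2] at h

/-- The order is divisible by p - 1 by reduction mod p. It is divisible by p^k because 2^(p-1) = 1 +
pa with p ∤ a has order p^k modulo p^(k+1). -/
theorem orderOf_two_prime_pow {p : ℕ} (hp : p.Prime) (hp2 : p ≠ 2)
    (h2 : orderOf (2 : ZMod p) = p - 1) (hW : ¬ 2 ^ (p - 1) ≡ 1 [MOD p ^ 2]) (k : ℕ) :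
    orderOf (2 : ZMod (p ^ (k + 1))) = (p ^ (k + 1)).totient := by
  refine Nat.dvd_antisymm ?_ ?_
  · have hc : Nat.Coprime 2 (p ^ (k + 1)) :=
      Nat.Coprime.pow_right _ ((Nat.coprime_primes Nat.prime_two hp).2 hp2.symm)
    have := ZMod.pow_totient (ZMod.unitOfCoprime 2 hc)
    rw [← orderOf_dvd_iff_pow_eq_one, ← orderOf_units] at this
    simpa using this
  · rw [Nat.totient_prime_pow_succ hp]
    refine Nat.Coprime.mul_dvd_of_dvd_of_dvd ?_ ?_ (pred_dvd_orderOf_two h2 k)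
    · refine Nat.Coprime.pow_left _ ((Nat.Prime.coprime_iff_not_dvd hp).2 fun h => ?_)
      have := Nat.le_of_dvd (by have := hp.two_le; omega) h
      have := hp.two_le
      omega
    · have h1 : (2 : ZMod p) ^ (p - 1) = 1 := by rw [← h2, pow_orderOf_eq_one]
      obtain ⟨a, ha⟩ : (p : ℤ) ∣ 2 ^ (p - 1) - 1 := by
        rw [← ZMod.intCast_zmod_eq_zero_iff_dvd]
        push_cast
        rw [h1, sub_self]
      have hpa : ¬ (p : ℤ) ∣ a := fun ⟨b, hb⟩ => hW <| by
        refine (Nat.modEq_iff_dvd.2 ?_).symm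
        push_cast
        exact ⟨b, by rw [ha, hb]; ring⟩
      have h3 := ZMod.orderOf_one_add_mul_prime hp hp2 a hpa k
      have h4 : (1 + p * a : ZMod (p ^ (k + 1))) = 2 ^ (p - 1) := by
        have : (2 : ℤ) ^ (p - 1) = 1 + p * a := by linarith
        have := congrArg (Int.cast : ℤ → ZMod (p ^ (k + 1))) this
        push_cast at this
        exact this.symm
      rw [h4] at h3
      rw [← h3]
      exact orderOf_pow_dvd _

theorem irreducible_cyclotomic_prime_pow {p : ℕ} (hp : p.Prime) (hp2 : p ≠ 2)
    (h2 : orderOf (2 : ZMod p) = p - 1) (hW : ¬ 2 ^ (p - 1) ≡ 1 [MOD p ^ 2]) (k : ℕ) :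
    Irreducible (cyclotomic (p ^ (k + 1)) (ZMod 2)) := by
  have hd : ¬ 2 ∣ p ^ (k + 1) := fun h =>
    hp2 ((Nat.prime_dvd_prime_iff_eq Nat.prime_two hp).1 (Nat.prime_two.dvd_of_dvd_pow h)).symm
  refine ZMod.irreducible_of_dvd_cyclotomic_of_natDegree hd dvd_rfl ?_
  rw [natDegree_cyclotomic, ← orderOf_two_prime_pow hp hp2 h2 hW, ← orderOf_units]
  simp

theorem dvd_X_pow_sub_one_of_not_repetitionPoly_dvd {p : ℕ} (hp : p.Prime) (hp2 : p ≠ 2)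
    (h2 : orderOf (2 : ZMod p) = p - 1) (hW : ¬ 2 ^ (p - 1) ≡ 1 [MOD p ^ 2]) {k : ℕ}
    {g : (ZMod 2)[X]} (hg : g ∣ X ^ p ^ (k + 1) + 1) (hP : ¬ repetitionPoly p (p ^ (k + 1)) ∣ g) :
    g ∣ X ^ p ^ k - 1 := by
  have := Fact.mk hp
  have h1 : repetitionPoly p (p ^ (k + 1)) = cyclotomic (p ^ (k + 1)) (ZMod 2) := by
    rw [repetitionPoly, cyclotomic_prime_pow_eq_geom_sum hp, pow_succ,
      Nat.mul_div_cancel _ hp.pos]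
    simp [← pow_mul, mul_comm]
  rw [h1] at hP
  have hirr := irreducible_cyclotomic_prime_pow hp hp2 h2 hW k
  rw [← CharTwo.sub_eq_add, ← cyclotomic_prime_pow_mul_X_pow_sub_one] at hg
  exact ((hirr.coprime_iff_not_dvd.2 hP).symm).dvd_of_dvd_mul_left hg

/-- Every irreducible factor other than Z - 1 divides a cyclotomic polynomial of order p^(i+1), so
its degree is the order of 2 there, a multiple of p - 1. Separability lets Z - 1 occur only once. -/
theorem natDegree_le_one_or_pred_le {p : ℕ} (hp : p.Prime) (hp2 : p ≠ 2)
    (h2 : orderOf (2 : ZMod p) = p - 1) {k : ℕ} {g : (ZMod 2)[X]}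
    (hg : g ∣ X ^ p ^ k - 1) : g.natDegree ≤ 1 ∨ p - 1 ≤ g.natDegree := by
  by_contra! hcon
  have hpk : (p ^ k : ZMod 2) ≠ 0 := by
    have : ¬ 2 ∣ p ^ k := fun h =>
      hp2 ((Nat.prime_dvd_prime_iff_eq Nat.prime_two hp).1 (Nat.prime_two.dvd_of_dvd_pow h)).symm
    rw [← CharP.cast_eq_zero_iff (ZMod 2) 2] at this
    exact_mod_cast this
  have hsep : (X ^ p ^ k - C 1 : (ZMod 2)[X]).Separable :=
    separable_X_pow_sub_C 1 (by exact_mod_cast hpk) one_ne_zero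
  rw [C_1] at hsep
  have hg0 : g ≠ 0 := by
    rintro rfl
    simp at hcon
  have hfac : ∀ f : (ZMod 2)[X], Irreducible f → f ∣ g → Associated f (X - 1) := by
    intro f hf hfg
    have h1 := hfg.trans hg
    rw [← prod_cyclotomic_eq_X_pow_sub_one (pow_pos hp.pos k), Nat.divisors_prime_pow hp,
      Finset.prod_map, hf.prime.dvd_finsetProd_iff] at h1
    obtain ⟨i, -, hi⟩ := h1
    rcases i with _ | i
    · simp only [Function.Embedding.coeFn_mk, pow_zero, cyclotomic_one] at hi
      exact hf.associated_of_dvd (by simpa using irreducible_X_sub_C (1 : ZMod 2)) hi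
    · exfalso
      have hc : Nat.Coprime 2 (p ^ (i + 1)) :=
        Nat.Coprime.pow_right _ ((Nat.coprime_primes Nat.prime_two hp).2 hp2.symm)
      have h3 := natDegree_of_dvd_cyclotomic_of_irreducible (K := ZMod 2) (p := 2) (f := 1)
        (by simp) hc hi hf
      have h4 : f.natDegree = orderOf (2 : ZMod (p ^ (i + 1))) := by
        rw [h3, ← orderOf_units]
        simp
      have h5 := pred_dvd_orderOf_two h2 i
      rw [← h4] at h5
      have h6 := Nat.le_of_dvd hf.natDegree_pos h5
      have h7 := natDegree_le_of_dvd hfg hg0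
      omega
  have hgu : ¬ IsUnit g := fun h => by
    have := natDegree_eq_zero_of_isUnit h
    omega
  obtain ⟨f, hf, h, rfl⟩ := WfDvdMonoid.exists_irreducible_factor hgu hg0
  have hf1 := hfac f hf (dvd_mul_right _ _)
  have hfdeg : f.natDegree = 1 := by
    rw [natDegree_eq_of_degree_eq (degree_eq_degree_of_associated hf1)]
    simpa using natDegree_X_sub_C (1 : ZMod 2)
  have hh0 : h ≠ 0 := right_ne_zero_of_mul hg0
  rw [natDegree_mul hf.ne_zero hh0, hfdeg] at hcon
  have hhu : ¬ IsUnit h := fun h => by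
    have := natDegree_eq_zero_of_isUnit h
    omega
  obtain ⟨f', hf', h', rfl⟩ := WfDvdMonoid.exists_irreducible_factor hhu hh0
  have hf1' := hfac f' hf' ((dvd_mul_right _ _).trans (dvd_mul_left _ _))
  refine hf.not_isUnit (hsep.squarefree f (Dvd.dvd.trans ?_ hg))
  exact mul_dvd_mul_left f ((hf1.trans hf1'.symm).dvd.trans (dvd_mul_right _ _))

/-! ### Dimension of the code, and folding of codewords modulo s. -/

theorem vecPoly_coeff {n : ℕ} (x : Fin n → ZMod 2) (i : Fin n) : (vecPoly x).coeff i = x i := by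
  rw [vecPoly, finsetSum_coeff, Finset.sum_eq_single i]
  · simp
  · intro j _ hj
    rw [coeff_C_mul, coeff_X_pow, if_neg fun h => hj (Fin.ext h.symm), mul_zero]
  · simp

/-- `vecPoly` as a linear map to the quotient by `g`. -/
noncomputable def syndromeMap (n : ℕ) (g : (ZMod 2)[X]) :
    (Fin n → ZMod 2) →ₗ[ZMod 2] AdjoinRoot g where
  toFun x := AdjoinRoot.mk g (vecPoly x)
  map_add' x y := by simp [vecPoly, add_mul, Finset.sum_add_distrib]
  map_smul' c x := by
    simp [vecPoly, mul_assoc, ← Finset.mul_sum, Algebra.smul_def]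

theorem IsGeneratorPoly.ker_syndromeMap {n : ℕ} {D : Submodule (ZMod 2) (Fin n → ZMod 2)}
    {g : (ZMod 2)[X]} (h : IsGeneratorPoly D g) : LinearMap.ker (syndromeMap n g) = D := by
  ext x
  rw [LinearMap.mem_ker, h.2.2 x, ← AdjoinRoot.mk_eq_zero]
  rfl

theorem syndromeMap_surjective {n : ℕ} {g : (ZMod 2)[X]} (hg : g.Monic) (hn : g.natDegree ≤ n) :
    Function.Surjective (syndromeMap n g) := by
  intro q
  obtain ⟨f, rfl⟩ := AdjoinRoot.mk_surjective q
  refine ⟨fun i => (f %ₘ g).coeff i, ?_⟩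
  have h1 : vecPoly (fun i : Fin n => (f %ₘ g).coeff i) = f %ₘ g := by
    rw [vecPoly, Fin.sum_univ_eq_sum_range fun i => C ((f %ₘ g).coeff i) * X ^ i]
    -- The strict degree bound on the remainder fails for g = 1, where the remainder is zero.
    rcases eq_or_ne g 1 with rfl | h
    · simp
    · exact ((f %ₘ g).as_sum_range_C_mul_X_pow'
        ((natDegree_modByMonic_lt f hg h).trans_le hn)).symm
  change AdjoinRoot.mk g _ = _
  rw [h1, AdjoinRoot.mk_eq_mk]
  exact ⟨-(f /ₘ g), by linear_combination (modByMonic_add_div f g)⟩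

theorem IsGeneratorPoly.finrank_add_natDegree {n : ℕ}
    {D : Submodule (ZMod 2) (Fin n → ZMod 2)} {g : (ZMod 2)[X]} (h : IsGeneratorPoly D g)
    (hn : g.natDegree ≤ n) : Module.finrank (ZMod 2) D + g.natDegree = n := by
  have h1 := LinearMap.finrank_range_add_finrank_ker (syndromeMap n g)
  rw [LinearMap.range_eq_top.2 (syndromeMap_surjective h.1 hn), finrank_top,
    h.ker_syndromeMap, (AdjoinRoot.powerBasis' h.1).finrank, Module.finrank_fin_fun] at h1
  simp at h1
  omega

/-- Modulo g one has Z^s = 1, so Z^(a+sk) may be replaced by Z^a. -/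
theorem dvd_sum_residue_of_dvd_vecPoly {n p s : ℕ} (e : Fin s × Fin p ≃ Fin n)
    (he : ∀ a k, (e (a, k) : ℕ) = a + s * k) {g : (ZMod 2)[X]} (hg : g ∣ X ^ s - 1)
    {x : Fin n → ZMod 2} (hx : g ∣ vecPoly x) :
    g ∣ ∑ a : Fin s, C (∑ k, x (e (a, k))) * X ^ (a : ℕ) := by
  refine (dvd_iff_dvd_of_dvd_sub ?_).1 hx
  rw [vecPoly, ← Equiv.sum_comp e, Fintype.sum_prod_type, ← Finset.sum_sub_distrib]
  refine Finset.dvd_sum fun a _ => ?_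
  rw [map_sum, Finset.sum_mul, ← Finset.sum_sub_distrib]
  refine Finset.dvd_sum fun k _ => ?_
  rw [he, pow_add, pow_mul]
  have h1 : g ∣ (X ^ s) ^ (k : ℕ) - 1 := hg.trans (sub_one_dvd_pow_sub_one _ _)
  rw [show ∀ b c d : (ZMod 2)[X], b * (c * d) - b * c = b * c * (d - 1) by intros; ring]
  exact h1.mul_left _

/-- The folded word is a multiple of g of degree below deg g, hence zero. -/
theorem sum_residue_eq_zero {n p s : ℕ} (e : Fin s × Fin p ≃ Fin n)
    (he : ∀ a k, (e (a, k) : ℕ) = a + s * k) {g : (ZMod 2)[X]} (hg : g ∣ X ^ s - 1)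
    {x : Fin n → ZMod 2} (hx : g ∣ vecPoly x)
    (hx0 : ∀ (a : Fin s) k, g.natDegree ≤ (a : ℕ) → x (e (a, k)) = 0) (a : Fin s) :
    ∑ k, x (e (a, k)) = 0 := by
  have h1 := dvd_sum_residue_of_dvd_vecPoly e he hg hx
  change g ∣ vecPoly fun a => ∑ k, x (e (a, k)) at h1
  have h0 : vecPoly (fun a => ∑ k, x (e (a, k))) = 0 := by
    by_contra hne
    have hg0 : g ≠ 0 := by
      rintro rfl
      exact hne (zero_dvd_iff.1 h1)
    refine hne (eq_zero_of_dvd_of_degree_lt h1 ?_)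
    rw [degree_eq_natDegree hg0]
    refine (degree_sum_le _ _).trans_lt ?_
    rw [Finset.sup_lt_iff (WithBot.bot_lt_coe _)]
    intro b _
    by_cases hb : g.natDegree ≤ (b : ℕ)
    · simp [hx0 b _ hb]
    · exact (degree_C_mul_X_pow_le _ _).trans_lt (by exact_mod_cast not_le.1 hb)
  rw [← vecPoly_coeff (fun a => ∑ k, x (e (a, k))) a, h0, coeff_zero]

/-! ### Pairs of codewords, split into outer coordinates and blocks. -/

theorem hammingNorm_eq_sum {ι : Type*} [Fintype ι] (v : ι → ZMod 2) :
    hammingNorm v = ∑ i, if v i ≠ 0 then 1 else 0 := by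
  rw [hammingNorm, Finset.card_filter]

/-- The pairs of codewords of `D` of total weight at most `W`. -/
noncomputable def codePairs {n : ℕ} (D : Submodule (ZMod 2) (Fin n → ZMod 2)) (W : ℕ) :
    Finset ((Fin n → ZMod 2) × (Fin n → ZMod 2)) :=
  open scoped Classical in Finset.univ.filter fun z =>
    z.1 ∈ D ∧ z.2 ∈ D ∧ hammingNorm z.1 + hammingNorm z.2 ≤ W

theorem pairWeightSum_eq_card_codePairs {n : ℕ} (D : Submodule (ZMod 2) (Fin n → ZMod 2))
    {w : ℝ} (hw : 0 ≤ w) : pairWeightSum D w = (codePairs D ⌊w⌋₊).card := by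
  classical
  rw [pairWeightSum, Finset.card_eq_sum_card_fiberwise
    (f := fun z => (hammingNorm z.1, hammingNorm z.2))
    (t := (Finset.range (n + 1) ×ˢ Finset.range (n + 1)).filter
      (fun ij : ℕ × ℕ => (ij.1 : ℝ) + (ij.2 : ℝ) ≤ w))]
  · refine Finset.sum_congr rfl fun ij hij => ?_
    obtain ⟨i, j⟩ := ij
    have hW : i + j ≤ ⌊w⌋₊ := by
      have := (Finset.mem_filter.1 hij).2
      refine Nat.le_floor ?_
      push_cast
      exact this
    have h1 : ∀ i, weightCount D i =
        (Finset.univ.filter fun x : Fin n → ZMod 2 => x ∈ D ∧ hammingNorm x = i).card :=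
      fun i => by
        rw [weightCount, ← Set.ncard_coe_finset]
        congr 1
        ext x
        simp
    rw [h1, h1, ← Finset.card_product]
    congr 1
    ext ⟨x, y⟩
    simp only [codePairs, Finset.mem_product, Finset.mem_filter, Finset.mem_univ, true_and,
      Prod.mk.injEq]
    constructor
    · rintro ⟨⟨hx, rfl⟩, hy, rfl⟩
      exact ⟨⟨hx, hy, hW⟩, rfl, rfl⟩
    · rintro ⟨⟨hx, hy, -⟩, rfl, rfl⟩
      exact ⟨⟨hx, rfl⟩, hy, rfl⟩
  · rintro ⟨x, y⟩ h
    simp only [codePairs, Finset.coe_filter, Finset.mem_univ, true_and, Set.mem_ofPred_eq] at h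
    have hx : hammingNorm x ≤ n := by simpa using hammingNorm_le_card_fintype (x := x)
    have hy : hammingNorm y ≤ n := by simpa using hammingNorm_le_card_fintype (x := y)
    have := (Nat.le_floor_iff hw).1 h.2.2
    push_cast at this
    simp only [Finset.coe_filter, Finset.mem_product, Finset.mem_range, Set.mem_ofPred_eq]
    exact ⟨⟨by omega, by omega⟩, this⟩

section

variable {n p s : ℕ} (e : Fin s × Fin p ≃ Fin n) (r : ℕ)

/-- The coordinates of `x` whose residue is at least `r`. -/
def outerPart (x : Fin n → ZMod 2) : {a : Fin s // ¬ (a : ℕ) < r} × Fin p → ZMod 2 :=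
  fun i => x (e (i.1, i.2))

/-- The coordinates of `x` whose residue is below `r`, arranged in residue classes. -/
def blockPart (x : Fin n → ZMod 2) : {a : Fin s // (a : ℕ) < r} → Fin p → ZMod 2 :=
  fun a k => x (e (a, k))

theorem hammingNorm_outerPart_add (x : Fin n → ZMod 2) :
    hammingNorm (outerPart e r x) + ∑ a, hammingNorm (blockPart e r x a) = hammingNorm x := by
  simp only [hammingNorm_eq_sum, outerPart, blockPart]
  rw [← Equiv.sum_comp e, Fintype.sum_prod_type, Fintype.sum_prod_type, add_comm]
  exact Fintype.sum_subtype_add_sum_subtype (fun a : Fin s => (a : ℕ) < r)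
    fun a => ∑ k, if x (e (a, k)) ≠ 0 then 1 else 0

/-- The pair `(x, x')` split into its outer and block parts. -/
def splitPair (z : (Fin n → ZMod 2) × (Fin n → ZMod 2)) :
    (({a : Fin s // ¬ (a : ℕ) < r} × Fin p ⊕ {a : Fin s // ¬ (a : ℕ) < r} × Fin p) → ZMod 2) ×
    (({a : Fin s // (a : ℕ) < r} ⊕ {a : Fin s // (a : ℕ) < r}) → Fin p → ZMod 2) :=
  (Sum.elim (outerPart e r z.1) (outerPart e r z.2),
    Sum.elim (blockPart e r z.1) (blockPart e r z.2))

theorem splitPair_injective : Function.Injective (splitPair e r) := by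
  have key : ∀ x y : Fin n → ZMod 2, outerPart e r x = outerPart e r y →
      blockPart e r x = blockPart e r y → x = y := by
    intro x y ho hb
    ext i
    obtain ⟨⟨a, k⟩, rfl⟩ := e.surjective i
    by_cases h : (a : ℕ) < r
    · exact congrFun (congrFun hb ⟨a, h⟩) k
    · exact congrFun ho (⟨a, h⟩, k)
  rintro ⟨x, x'⟩ ⟨y, y'⟩ h
  simp only [splitPair, Prod.mk.injEq, Sum.elim_eq_iff] at h
  exact Prod.ext (key _ _ h.1.1 h.2.1) (key _ _ h.1.2 h.2.2)

theorem hammingNorm_splitPair (z : (Fin n → ZMod 2) × (Fin n → ZMod 2)) :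
    hammingNorm (splitPair e r z).1 + ∑ k, hammingNorm ((splitPair e r z).2 k) =
      hammingNorm z.1 + hammingNorm z.2 := by
  have h1 : hammingNorm (splitPair e r z).1 =
      hammingNorm (outerPart e r z.1) + hammingNorm (outerPart e r z.2) := by
    simp only [hammingNorm_eq_sum, splitPair, Fintype.sum_sum_type, Sum.elim_inl, Sum.elim_inr]
    rfl
  rw [h1, Fintype.sum_sum_type, ← hammingNorm_outerPart_add e r z.1,
    ← hammingNorm_outerPart_add e r z.2]
  simp only [splitPair, Sum.elim_inl, Sum.elim_inr]
  ring

/-- Two codewords with the same outer part differ by a codeword vanishing there, to which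
`sum_residue_eq_zero` applies; each component of the pair is treated separately. -/
theorem IsGeneratorPoly.determinesParities {D : Submodule (ZMod 2) (Fin n → ZMod 2)}
    {g : (ZMod 2)[X]} (h : IsGeneratorPoly D g) (he : ∀ a k, (e (a, k) : ℕ) = a + s * k)
    (hg : g ∣ X ^ s - 1) (W : ℕ) :
    DeterminesParities ((codePairs D W).image (splitPair e g.natDegree)) := by
  classical
  have key : ∀ x ∈ D, ∀ y ∈ D, outerPart e g.natDegree x = outerPart e g.natDegree y →
      ∀ a : {a : Fin s // (a : ℕ) < g.natDegree},
        ∑ k, x (e (a, k)) = ∑ k, y (e (a, k)) := by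
    intro x hx y hy ho a
    rw [← sub_eq_zero, ← Finset.sum_sub_distrib]
    refine sum_residue_eq_zero e he hg ((h.2.2 (x - y)).1 (D.sub_mem hx hy)) ?_ a.1
    intro b k hb
    exact sub_eq_zero.2 (congrFun ho (⟨b, not_lt.2 hb⟩, k))
  intro u y y' hy hy'
  rw [Finset.mem_image] at hy hy'
  obtain ⟨⟨x₁, x₂⟩, hx, hxy⟩ := hy
  obtain ⟨⟨x₁', x₂'⟩, hx', hxy'⟩ := hy'
  simp only [codePairs, Finset.mem_filter, Finset.mem_univ, true_and] at hx hx'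
  simp only [splitPair, Prod.mk.injEq] at hxy hxy'
  obtain ⟨rfl, rfl⟩ := hxy
  obtain ⟨hu, rfl⟩ := hxy'
  rw [Sum.elim_eq_iff] at hu
  rintro (a | a)
  · exact (key _ hx'.1 _ hx.1 hu.1 a).symm
  · exact (key _ hx'.2.1 _ hx.2.1 hu.2 a).symm

theorem IsGeneratorPoly.card_codePairs_le {D : Submodule (ZMod 2) (Fin n → ZMod 2)}
    {g : (ZMod 2)[X]} (h : IsGeneratorPoly D g) (he : ∀ a k, (e (a, k) : ℕ) = a + s * k)
    (hg : g ∣ X ^ s - 1) (hs : g.natDegree ≤ s) (h2 : 2 ≤ g.natDegree) {W : ℕ} (hW0 : 0 < W)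
    (hW1 : 2 * n ≤ 20 * W) (hW2 : 4 * W ≤ 2 * n) (hp : (9 / 10 : ℝ) ^ p ≤ 1 / 20) :
    ((codePairs D W).card : ℝ) ≤ 16 * ((2 * g.natDegree * p : ℝ) ^ 2 + 1) *
      (21 / 40) ^ (2 * g.natDegree) * (2 * n).choose W := by
  classical
  have hlt : Fintype.card {a : Fin s // (a : ℕ) < g.natDegree} = g.natDegree := by
    rw [Fintype.card_subtype, Fin.card_filter_val_lt]
    exact min_eq_right hs
  have hnlt : Fintype.card {a : Fin s // ¬ (a : ℕ) < g.natDegree} = s - g.natDegree := by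
    rw [Fintype.card_subtype_compl, hlt, Fintype.card_fin]
  have hn : s * p = n := by simpa using Fintype.card_congr e
  have hp0 : 0 < p := by
    rcases Nat.eq_zero_or_pos p with rfl | h
    · norm_num at hp
    · exact h
  have hcard := (h.determinesParities e he hg W).card_pairBall_le (N := 2 * n)
    (M := 2 * g.natDegree * p) (W := W) (by
      rw [Fintype.card_sum, hlt, Fintype.card_fin]
      ring) (by
      rw [Fintype.card_sum, Fintype.card_prod, hnlt, Fintype.card_fin, ← hn]
      obtain ⟨d, hd⟩ := Nat.exists_eq_add_of_le hs
      rw [hd, Nat.add_sub_cancel_left]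
      ring) (by nlinarith) hW0 hW1 hW2 (by rwa [Fintype.card_fin])
  have hle : (codePairs D W).card ≤
      (pairBall ((codePairs D W).image (splitPair e g.natDegree)) W).card := by
    rw [← Finset.card_image_of_injective _ (splitPair_injective e g.natDegree)]
    refine Finset.card_le_card fun y hy => ?_
    refine Finset.mem_filter.2 ⟨hy, ?_⟩
    obtain ⟨z, hz, rfl⟩ := Finset.mem_image.1 hy
    rw [hammingNorm_splitPair]
    exact (Finset.mem_filter.1 hz).2.2.2
  refine (Nat.cast_le.2 hle).trans (hcard.trans (le_of_eq ?_))
  rw [Fintype.card_sum, hlt, two_mul g.natDegree]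
  push_cast
  ring

end

/-! ### The size of the punctured ball, and trivial bounds for pairs. -/

theorem puncturedBall_eq_coe (N : ℕ) {w : ℝ} (hw : 0 ≤ w) :
    puncturedBall N w = ((Finset.univ.filter fun x : Fin N → ZMod 2 =>
      x ≠ 0 ∧ hammingNorm x ≤ ⌊w⌋₊ : Finset (Fin N → ZMod 2)) : Set (Fin N → ZMod 2)) := by
  ext x
  simp [puncturedBall, Nat.le_floor_iff hw]

theorem choose_le_ncard_puncturedBall (N : ℕ) {w : ℝ} (hw : 0 ≤ w) (hW : 0 < ⌊w⌋₊) :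
    N.choose ⌊w⌋₊ ≤ (puncturedBall N w).ncard := by
  rw [puncturedBall_eq_coe N hw, Set.ncard_coe_finset]
  have := card_hammingNorm_eq (ι := Fin N) ⌊w⌋₊
  rw [Fintype.card_fin] at this
  rw [← this]
  refine Finset.card_le_card fun x hx => ?_
  simp only [Finset.mem_filter, Finset.mem_univ, true_and] at hx ⊢
  exact ⟨hammingNorm_ne_zero_iff.1 (by omega), hx.le⟩

/-- Chernoff's bound at t = K/(1-K) = 1/9. Since W ≤ n/5, fifth powers clear the fraction and leave
(10/9)^10 ≤ 2^5/9. -/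
theorem ncard_puncturedBall_le_two_pow (n : ℕ) :
    ((puncturedBall (2 * n) (2 * (1 / 10) * n)).ncard : ℝ) ≤ 2 ^ n := by
  have hw : (0 : ℝ) ≤ 2 * (1 / 10) * n := by positivity
  set W := ⌊(2 * (1 / 10) * n : ℝ)⌋₊ with hWdef
  have hW5 : 5 * W ≤ n := by
    have := Nat.floor_le hw
    rw [← hWdef] at this
    have : (5 * W : ℝ) ≤ n := by linarith
    exact_mod_cast this
  rw [puncturedBall_eq_coe _ hw, Set.ncard_coe_finset, ← hWdef]
  set B := Finset.univ.filter fun x : Fin (2 * n) → ZMod 2 => x ≠ 0 ∧ hammingNorm x ≤ W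
  have h1 : (B.card : ℝ) * (1 / 9) ^ W ≤ (1 + 1 / 9) ^ (2 * n) := by
    calc (B.card : ℝ) * (1 / 9) ^ W = ∑ x ∈ B, (1 / 9 : ℝ) ^ W := by simp
      _ ≤ ∑ x ∈ B, (1 / 9 : ℝ) ^ hammingNorm x := Finset.sum_le_sum fun x hx =>
          pow_le_pow_of_le_one (by norm_num) (by norm_num) (Finset.mem_filter.1 hx).2.2
      _ ≤ ∑ x, (1 / 9 : ℝ) ^ hammingNorm x :=
          Finset.sum_le_sum_of_subset_of_nonneg (Finset.subset_univ _)
            fun _ _ _ => by positivity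
      _ = _ := by rw [sum_pow_hammingNorm, Fintype.card_fin]
  refine le_of_pow_le_pow_left₀ (n := 5) (by norm_num) (by positivity) ?_
  have h2 : (1 / 9 : ℝ) ^ n ≤ ((1 / 9 : ℝ) ^ W) ^ 5 := by
    rw [← pow_mul]
    exact pow_le_pow_of_le_one (by norm_num) (by norm_num) (by omega)
  have h3 : (B.card : ℝ) ^ 5 * (1 / 9) ^ n ≤ ((10 / 9 : ℝ) ^ 10) ^ n := by
    calc (B.card : ℝ) ^ 5 * (1 / 9) ^ n ≤ (B.card : ℝ) ^ 5 * ((1 / 9 : ℝ) ^ W) ^ 5 := by gcongr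
      _ = (B.card * (1 / 9 : ℝ) ^ W) ^ 5 := by rw [mul_pow]
      _ ≤ ((1 + 1 / 9) ^ (2 * n)) ^ 5 := by gcongr
      _ = _ := by
          rw [← pow_mul, ← pow_mul]
          congr 1
          · norm_num
          · ring
  have h4 : ((10 / 9 : ℝ) ^ 10) ^ n ≤ (2 ^ n) ^ 5 * (1 / 9) ^ n := by
    rw [show ((2 : ℝ) ^ n) ^ 5 = (2 ^ 5) ^ n by rw [← pow_mul, ← pow_mul, mul_comm], ← mul_pow]
    exact pow_le_pow_left₀ (by norm_num) (by norm_num) _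
  exact le_of_mul_le_mul_right (h3.trans h4) (by positivity)

/-- The concatenation of two words of length `n`. -/
def concatPair {n : ℕ} (z : (Fin n → ZMod 2) × (Fin n → ZMod 2)) : Fin (2 * n) → ZMod 2 :=
  fun i => Sum.elim z.1 z.2 (finSumFinEquiv.symm (finCongr (two_mul n) i))

theorem concatPair_injective (n : ℕ) : Function.Injective (concatPair (n := n)) := by
  rintro ⟨x, x'⟩ ⟨y, y'⟩ h
  have h1 : Sum.elim x x' = Sum.elim y y' := by
    ext i
    obtain ⟨j, rfl⟩ := ((finCongr (two_mul n)).trans finSumFinEquiv.symm).surjective i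
    exact congrFun h j
  rw [Sum.elim_eq_iff] at h1
  exact Prod.ext h1.1 h1.2

theorem hammingNorm_concatPair {n : ℕ} (z : (Fin n → ZMod 2) × (Fin n → ZMod 2)) :
    hammingNorm (concatPair z) = hammingNorm z.1 + hammingNorm z.2 := by
  simp only [hammingNorm_eq_sum]
  rw [← Equiv.sum_comp (finSumFinEquiv.trans (finCongr (two_mul n)).symm), Fintype.sum_sum_type]
  simp [concatPair, -finSumFinEquiv_apply_left, -finSumFinEquiv_apply_right]

theorem card_codePairs_le_ncard_add_one {n : ℕ} (D : Submodule (ZMod 2) (Fin n → ZMod 2))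
    {w : ℝ} (hw : 0 ≤ w) : (codePairs D ⌊w⌋₊).card ≤ (puncturedBall (2 * n) w).ncard + 1 := by
  classical
  rw [puncturedBall_eq_coe _ hw, Set.ncard_coe_finset,
    ← Finset.card_image_of_injective _ (concatPair_injective n)]
  refine le_trans (Finset.card_le_card fun v hv => ?_) (Finset.card_insert_le 0 _)
  obtain ⟨z, hz, rfl⟩ := Finset.mem_image.1 hv
  have := (Finset.mem_filter.1 hz).2.2.2
  rw [← hammingNorm_concatPair] at this
  simp only [Finset.mem_insert, Finset.mem_filter, Finset.mem_univ, true_and]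
  tauto

/-- The zero pair is not in the punctured ball, but a proper code misses some unit vector, and the
corresponding word of weight one makes up for it. -/
theorem card_codePairs_le_ncard {n : ℕ} {D : Submodule (ZMod 2) (Fin n → ZMod 2)} (hD : D ≠ ⊤)
    {w : ℝ} (hw : 1 ≤ w) : (codePairs D ⌊w⌋₊).card ≤ (puncturedBall (2 * n) w).ncard := by
  classical
  obtain ⟨i, hi⟩ : ∃ i : Fin n, Pi.single i (1 : ZMod 2) ∉ D := by
    by_contra! h
    refine hD (top_le_iff.1 ?_)
    rw [← (Pi.basisFun (ZMod 2) (Fin n)).span_eq, Submodule.span_le]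
    rintro _ ⟨i, rfl⟩
    simpa using h i
  have hw0 : 0 ≤ w := by linarith
  have h1 : 1 ≤ ⌊w⌋₊ := (Nat.one_le_floor_iff w).2 hw
  set v := concatPair (Pi.single i (1 : ZMod 2), 0) with hv
  have hvn : hammingNorm v = 1 := by
    rw [hv, hammingNorm_concatPair, hammingNorm_zero, add_zero, hammingNorm_eq_sum]
    simp [Pi.single_apply]
  rw [puncturedBall_eq_coe _ hw0, Set.ncard_coe_finset,
    ← Finset.card_image_of_injective _ (concatPair_injective n)]
  set B := Finset.univ.filter fun x : Fin (2 * n) → ZMod 2 => x ≠ 0 ∧ hammingNorm x ≤ ⌊w⌋₊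
  have hvB : v ∈ B := by
    refine Finset.mem_filter.2 ⟨Finset.mem_univ _, ?_, by omega⟩
    exact hammingNorm_ne_zero_iff.1 (by omega)
  refine (Finset.card_le_card (t := insert 0 (B.erase v)) fun y hy => ?_).trans
    ((Finset.card_insert_le 0 _).trans (Finset.card_erase_add_one hvB).le)
  obtain ⟨z, hz, rfl⟩ := Finset.mem_image.1 hy
  have hz2 := (Finset.mem_filter.1 hz).2
  have h3 := hz2.2.2
  rw [← hammingNorm_concatPair] at h3
  have h4 : concatPair z ≠ v := fun h => by
    have := concatPair_injective n h
    rw [this] at hz2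
    exact hi hz2.1
  simp only [B, Finset.mem_insert, Finset.mem_erase, Finset.mem_filter, Finset.mem_univ, true_and]
  tauto

/-! ### Absorbing the polynomial factor, and conclusion. -/

theorem pow_ten_le_two_pow {r : ℕ} (hr : 59 ≤ r) : r ^ 10 ≤ 2 ^ r := by
  induction r, hr using Nat.le_induction with
  | base => norm_num
  | succ r hr ih =>
    have h1 : (59 * (r + 1)) ^ 10 ≤ (60 * r) ^ 10 := Nat.pow_le_pow_left (by omega) _
    rw [mul_pow, mul_pow] at h1
    rw [pow_succ 2 r]
    norm_num at h1
    omega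

/-- The factor is O(r⁴) because p ≤ r + 1. After raising to the fifth power it is at most 8^r, and
8·(21/40)^10 ≤ 2^(-6). -/
theorem pairCount_factor_le {r p : ℕ} (hr : 59 ≤ r) (hp : p ≤ r + 1) {γ : ℝ} (hγ : 0 < γ)
    (hγ5 : γ ^ 5 = 1 / 2) :
    16 * ((2 * r * p : ℝ) ^ 2 + 1) * (21 / 40) ^ (2 * r) ≤ γ ^ (6 * r) := by
  have hr' : (59 : ℝ) ≤ r := by exact_mod_cast hr
  have hp' : (p : ℝ) ≤ r + 1 := by exact_mod_cast hp
  have hF : 16 * ((2 * r * p : ℝ) ^ 2 + 1) ≤ 128 * (r : ℝ) ^ 4 := by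
    have h1 : (2 * r * p : ℝ) ≤ (2 * r) * (r * (60 / 59)) := by
      gcongr
      linarith
    have h2 : (2 * r * p : ℝ) ^ 2 ≤ ((2 * r) * (r * (60 / 59))) ^ 2 := by gcongr
    have h3 : (1 : ℝ) ≤ (r : ℝ) ^ 4 := one_le_pow₀ (by linarith)
    nlinarith
  have h10 : (r : ℝ) ^ 10 ≤ 2 ^ r := by exact_mod_cast pow_ten_le_two_pow hr
  have h35 : (2 : ℝ) ^ 35 ≤ 2 ^ r := pow_le_pow_right₀ (by norm_num) (by omega)
  have hF5 : (16 * ((2 * r * p : ℝ) ^ 2 + 1)) ^ 5 ≤ 8 ^ r := by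
    calc _ ≤ (128 * (r : ℝ) ^ 4) ^ 5 := by gcongr
      _ = 2 ^ 35 * ((r : ℝ) ^ 10 * (r : ℝ) ^ 10) := by ring
      _ ≤ 2 ^ r * (2 ^ r * 2 ^ r) := by gcongr
      _ = 8 ^ r := by rw [← mul_pow, ← mul_pow]; norm_num
  refine le_of_pow_le_pow_left₀ (n := 5) (by norm_num) (by positivity) ?_
  rw [mul_pow, ← pow_mul γ, mul_comm (6 * r), pow_mul γ, hγ5, ← pow_mul,
    show 2 * r * 5 = 10 * r by ring, pow_mul, pow_mul (1 / 2 : ℝ)]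
  calc _ ≤ (8 : ℝ) ^ r * ((21 / 40) ^ 10) ^ r := by gcongr
    _ = (8 * (21 / 40) ^ 10) ^ r := by rw [mul_pow]
    _ ≤ _ := pow_le_pow_left₀ (by norm_num) (by norm_num) _

/-- Pairs of codewords of a cyclic code of codimension `r`: their number in the ball, up to the
factor `2 ^ r`, is at most `γ ^ (r - 1)` times twice the size of the punctured ball. -/
theorem pairWeightSum_le {p k n : ℕ} (hp : p.Prime) (h2 : orderOf (2 : ZMod p) = p - 1)
    (hW : ¬ 2 ^ (p - 1) ≡ 1 [MOD p ^ 2]) (hq : 14 ^ 3 ≤ p) (hn : n = p ^ (k + 1))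
    {w : ℝ} (hw1 : 1 / 10 ≤ w / (2 * n)) (hw2 : w / (2 * n) ≤ 1 / 4)
    {D : Submodule (ZMod 2) (Fin n → ZMod 2)} (hD : D ∈ nonRepetitiveCyclicCodes p n)
    {γ : ℝ} (hγ : 0 < γ) (hγ1 : γ ≤ 1) (hγ5 : γ ^ 5 = 1 / 2) {r : ℕ}
    (hr : Module.finrank (ZMod 2) D + r = n) :
    (pairWeightSum D w : ℝ) * (2 ^ r * γ) ≤ 2 * (puncturedBall (2 * n) w).ncard * γ ^ r := by
  obtain ⟨-, g, hg, hgP⟩ := hD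
  have hp2 : p ≠ 2 := by
    rintro rfl
    norm_num at hq
  set s := p ^ k with hs
  have hs0 : 0 < s := pow_pos hp.pos k
  have hns : n = p * s := by rw [hn, pow_succ, mul_comm]
  have hnp : p ≤ n := by
    rw [hns]
    exact Nat.le_mul_of_pos_right _ hs0
  have hgs : g ∣ X ^ s - 1 :=
    dvd_X_pow_sub_one_of_not_repetitionPoly_dvd hp hp2 h2 hW (by rw [← hn]; exact hg.2.1)
      (by rwa [← hn])
  have hdeg : g.natDegree ≤ s := by
    have := natDegree_le_of_dvd hgs (X_pow_sub_C_ne_zero hs0 1)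
    rwa [← C_1, natDegree_X_pow_sub_C] at this
  have hdim := hg.finrank_add_natDegree
    (hdeg.trans (by rw [hns]; exact Nat.le_mul_of_pos_left _ hp.pos))
  obtain rfl : r = g.natDegree := by omega
  have hn0 : (0 : ℝ) < 2 * n := by
    have : 0 < n := by omega
    positivity
  rw [le_div_iff₀ hn0] at hw1
  rw [div_le_iff₀ hn0] at hw2
  have hnR : (2744 : ℝ) ≤ n := by exact_mod_cast (by omega : 2744 ≤ n)
  have hw0 : 0 ≤ w := by linarith
  have hfl := Nat.lt_floor_add_one w
  have hfl' := Nat.floor_le hw0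
  have hW1 : 2 * n ≤ 20 * ⌊w⌋₊ := by
    have : (2 * n : ℝ) ≤ 20 * ⌊w⌋₊ := by linarith
    exact_mod_cast this
  have hW2 : 4 * ⌊w⌋₊ ≤ 2 * n := by
    have : (4 * ⌊w⌋₊ : ℝ) ≤ 2 * n := by linarith
    exact_mod_cast this
  have hB := choose_le_ncard_puncturedBall (2 * n) hw0 (by omega)
  have hB1 : 1 ≤ (puncturedBall (2 * n) w).ncard :=
    le_trans (Nat.choose_pos (by omega)) hB
  rw [pairWeightSum_eq_card_codePairs D hw0]
  have hBR : (1 : ℝ) ≤ (puncturedBall (2 * n) w).ncard := by exact_mod_cast hB1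
  -- For r = 0 the extra zero pair is covered by |B| + 1 ≤ 2|B|; for r = 1 the two sides carry the
  -- same factor 2γ, so the sharper count without the +1 is needed.
  rcases natDegree_le_one_or_pred_le hp hp2 h2 hgs with hsmall | hlarge
  · rcases Nat.le_one_iff_eq_zero_or_eq_one.1 hsmall with h0 | h1
    · have hc : ((codePairs D ⌊w⌋₊).card : ℝ) ≤ (puncturedBall (2 * n) w).ncard + 1 := by
        exact_mod_cast card_codePairs_le_ncard_add_one D hw0
      rw [h0]
      nlinarith
    · have hDtop : D ≠ ⊤ := by
        rintro rfl
        rw [finrank_top, Module.finrank_fin_fun] at hdim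
        omega
      have hc : ((codePairs D ⌊w⌋₊).card : ℝ) ≤ (puncturedBall (2 * n) w).ncard := by
        exact_mod_cast card_codePairs_le_ncard hDtop (by linarith)
      rw [h1]
      nlinarith
  -- The factors are swapped so that (a, k) is sent to a + sk.
  · let e : Fin s × Fin p ≃ Fin n :=
      (Equiv.prodComm _ _).trans (finProdFinEquiv.trans (finCongr hns.symm))
    have h9 : (9 / 10 : ℝ) ^ p ≤ 1 / 20 :=
      (pow_le_pow_of_le_one (by norm_num) (by norm_num) (by omega : 29 ≤ p)).trans (by norm_num)
    have hc := hg.card_codePairs_le e (fun a k => by simp [e]) hgs hdeg (by omega) (by omega)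
      hW1 hW2 h9
    have hf := pairCount_factor_le (r := g.natDegree) (p := p) (by omega) (by omega) hγ hγ5
    have hBC : ((2 * n).choose ⌊w⌋₊ : ℝ) ≤ (puncturedBall (2 * n) w).ncard := by
      exact_mod_cast hB
    set r := g.natDegree
    calc ((codePairs D ⌊w⌋₊).card : ℝ) * (2 ^ r * γ)
        ≤ (γ ^ (6 * r) * (puncturedBall (2 * n) w).ncard) * (2 ^ r * 1) := by
          gcongr
          exact hc.trans (by gcongr)
      -- Of the 6r factors γ, 5r cancel 2^r and the remaining r give the claimed decay.
      _ = (puncturedBall (2 * n) w).ncard * γ ^ r * ((γ ^ 5) ^ r * 2 ^ r) := by ring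
      _ = (puncturedBall (2 * n) w).ncard * γ ^ r := by
          rw [← mul_pow, hγ5]
          norm_num
      _ ≤ _ := by
          have : 0 ≤ (puncturedBall (2 * n) w).ncard * γ ^ r := by positivity
          linarith

theorem mainTheorem4 :
    ∃ (q : ℕ) (K c₁ γ : ℝ),
      q = 14 ^ 3 ∧ K = 1 / 10 ∧ c₁ = (2 : ℝ) ^ (6 / 5 : ℝ) ∧ γ = (2 : ℝ) ^ (-(1 / 5) : ℝ) ∧
      0 < q ∧ 0 < K ∧ 0 < c₁ ∧ 0 < γ ∧ γ < 1 ∧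
      ∀ (p m n : ℕ), p.Prime → orderOf (2 : ZMod p) = p - 1 → ¬ 2 ^ (p - 1) ≡ 1 [MOD p ^ 2] →
        q ≤ p → 1 ≤ m → n = p ^ m →
        ((puncturedBall (2 * n) (2 * K * n)).ncard : ℝ) ≤ 2 ^ n ∧
        ∀ w : ℝ, 0 < w → K ≤ w / (2 * n) → w / (2 * n) ≤ 1 / 4 →
          ∀ D ∈ nonRepetitiveCyclicCodes p n,
            (pairWeightSum D w : ℝ) * (1 / (Nat.card D : ℝ)) ≤
              c₁ * (((puncturedBall (2 * n) w).ncard : ℝ) / 2 ^ n) *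
                γ ^ (n - Module.finrank (ZMod 2) D) := by
  have hγ5 : ((2 : ℝ) ^ (-(1 / 5) : ℝ)) ^ 5 = 1 / 2 := by
    rw [← Real.rpow_natCast, ← Real.rpow_mul (by norm_num)]
    norm_num
  have hγ : (0 : ℝ) < (2 : ℝ) ^ (-(1 / 5) : ℝ) := by positivity
  have hγ1 : (2 : ℝ) ^ (-(1 / 5) : ℝ) < 1 :=
    Real.rpow_lt_one_of_one_lt_of_neg (by norm_num) (by norm_num)
  have hcγ : (2 : ℝ) ^ (6 / 5 : ℝ) * (2 : ℝ) ^ (-(1 / 5) : ℝ) = 2 := by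
    rw [← Real.rpow_add (by norm_num)]
    norm_num
  refine ⟨14 ^ 3, 1 / 10, _, _, rfl, rfl, rfl, rfl, by norm_num, by norm_num, by positivity,
    hγ, hγ1, ?_⟩
  intro p m n hp h2 hW hq hm hn
  refine ⟨ncard_puncturedBall_le_two_pow n, fun w _ hw1 hw2 D hD => ?_⟩
  obtain ⟨k, rfl⟩ : ∃ k, m = k + 1 := ⟨m - 1, by omega⟩
  have hfin : Module.finrank (ZMod 2) D ≤ n := by
    simpa using Submodule.finrank_le D
  obtain ⟨r, hr⟩ := Nat.exists_eq_add_of_le hfin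
  have key := pairWeightSum_le hp h2 hW hq hn hw1 hw2 hD hγ hγ1.le hγ5 hr.symm
  have hcard : (Nat.card D : ℝ) = 2 ^ Module.finrank (ZMod 2) D := by
    rw [Module.natCard_eq_pow_finrank (K := ZMod 2), Nat.card_zmod]
    norm_num
  have hnr : n - Module.finrank (ZMod 2) D = r := by omega
  have h2n : (2 : ℝ) ^ n = 2 ^ Module.finrank (ZMod 2) D * 2 ^ r := by rw [← pow_add, ← hr]
  rw [hnr, hcard, h2n]
  generalize (2 : ℝ) ^ (-(1 / 5) : ℝ) = γ at *
  generalize (2 : ℝ) ^ (6 / 5 : ℝ) = c at *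
  rw [mul_one_div, mul_div_assoc', div_mul_eq_mul_div,
    div_le_div_iff₀ (by positivity) (by positivity)]
  -- Multiplying by γ turns c₁ into c₁γ = 2, the constant of `pairWeightSum_le`.
  refine le_of_mul_le_mul_right ?_ hγ
  calc _ = (pairWeightSum D w * (2 ^ r * γ)) * 2 ^ Module.finrank (ZMod 2) D := by ring
    _ ≤ (2 * (puncturedBall (2 * n) w).ncard * γ ^ r) * 2 ^ Module.finrank (ZMod 2) D :=
        mul_le_mul_of_nonneg_right key (by positivity)
    _ = _ := by rw [← hcγ]; ring
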